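/- Let $G=(V,E,o)$ be a finite tree with root $o$, and let $(\eta_t)_{t\ge 0}$ be the continuous-time simple random walk on $G$ in the variable speed model, i.e. the (right-continuous) Markov chain on $V$ that crosses every edge at rate $1$; write $\mathbb{P}_v,\mathbb{E}_v$ for its law and expectation when $\eta_0=v$. Let $\pi$ be the uniform distribution on $V$, let $\|\mu-\nu\|_{\mathrm{TV}}=\max_{A\subseteq V}|\mu(A)-\nu(A)|$, and for $\epsilon\in(0,1)$ let $$t_{\mathrm{mix}}(\epsilon)=\inf\Big\{t\ge 0:\ \max_{x\in V}\|\mathbb{P}_x(\eta_t\in\cdot)-\pi\|_{\mathrm{TV}}\le\epsilon\Big\},\qquad \tau_{\mathrm{hit}}(o)=\inf\{t\ge 0:\eta_t=o\}.$$ For $v\in V$ let $\ell(v)$ be the set of edges of the shortest path from $o$ to $v$ and $|v|=|\ell(v)|$. Let $T_v$ be the largest subtree of $G$ that contains $v$ and consists only of vertices at distance at least $|v|$ from $o$; for an edge $e$ let $T_e=T_{e_+}$, where $e_+$ is the endpoint of $e$ farther from $o$, and let $|T_e|$ be its number of vertices. Let $\Delta$ be the maximum degree of $G$. Let $\delta>0$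 and assume that $o$ is a $\delta$-center of mass, i.e. there are two subtrees $T,\tilde T$ of $G$ with $V(T)\cap V(\tilde T)=\{o\}$, $V(T)\cup V(\tilde T)=V$, $|V(T)|\ge\delta|V|$ and $|V(\tilde T)|\ge\delta|V|$. Then for all $0<\varepsilon\le\delta$, $$t_{\mathrm{mix}}\Big(\frac{\varepsilon}{2}\Big)\ \ge\ \frac{\varepsilon}{2}\max_{v\in V}\mathbb{E}_v[\tau_{\mathrm{hit}}(o)]\ \ge\ \frac{\varepsilon}{2\Delta}\max_{v\in V}\sum_{e\in\ell(v)}|T_e|,$$ where the last expression is read as $0$ if $G$ has only one vertex. -/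

import Mathlib

open scoped ENNReal NNReal

noncomputable section

namespace TreeWalk

variable {V : Type*} [Fintype V]

/-! ### The variable speed simple random walk -/

/-- The generator of the variable speed walk, `Q x y = 1` if `x` and `y` are adjacent,
`Q x x = - deg x`, and `Q x y = 0` otherwise: every edge is crossed at rate `1`. -/
def generator [DecidableEq V] (G : SimpleGraph V) [DecidableRel G.Adj] : Matrix V V ℝ :=
  Matrix.of fun x y => if x = y then -(G.degree x : ℝ) else if G.Adj x y then 1 else 0

/-- The transition matrix `exp (t Q)` at time `t`. -/
def transition [DecidableEq V] (G : SimpleGraph V) [DecidableRel G.Adj] (t : ℝ) : Matrix V V ℝ :=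
  NormedSpace.exp (t • generator G)

/-- `(η t)` is, under the measures `P x` (`x` the starting point), the continuous-time Markov chain
with generator `Q`: its paths are right-continuous and its finite-dimensional distributions
are those given by the transition matrices `exp (t Q)`. -/
structure IsSimpleRandomWalk [DecidableEq V] (G : SimpleGraph V) [DecidableRel G.Adj]
    {Ω : Type*} [MeasurableSpace Ω] (P : V → MeasureTheory.Measure Ω) (η : ℝ≥0 → Ω → V) :
    Prop where
  isProbabilityMeasure : ∀ x, MeasureTheory.IsProbabilityMeasure (P x)
  measurableSet : ∀ t y, MeasurableSet {ω | η t ω = y}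
  rightContinuous : ∀ ω t, ∀ᶠ s in nhdsWithin t (Set.Ici t), η s ω = η t ω
  start : ∀ x, P x {ω | η 0 ω = x} = 1
  finiteDimensional : ∀ (x : V) (n : ℕ) (t : Fin (n + 1) → ℝ≥0), Monotone t →
    ∀ y : Fin (n + 1) → V,
      P x {ω | ∀ i, η (t i) ω = y i} =
        ENNReal.ofReal (transition G (t 0) x (y 0) *
          ∏ i : Fin n, transition G ((t i.succ : ℝ) - (t i.castSucc : ℝ))
            (y i.castSucc) (y i.succ))

/-! ### Mixing time and hitting times -/

/-- Total variation distance of two measures on `V` given by their mass functions. -/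
def tvDist (μ ν : V → ℝ) : ℝ :=
  (Finset.univ : Finset (Finset V)).sup' Finset.univ_nonempty
    fun A => |∑ a ∈ A, μ a - ∑ a ∈ A, ν a|

/-- The mass function of the law of `η t` under `P x`. -/
def law {Ω : Type*} [MeasurableSpace Ω] (P : V → MeasureTheory.Measure Ω) (η : ℝ≥0 → Ω → V)
    (x : V) (t : ℝ≥0) : V → ℝ :=
  fun y => (P x).real {ω | η t ω = y}

/-- The uniform distribution on `V`. -/
def uniform (V : Type*) [Fintype V] : V → ℝ := fun _ => 1 / (Fintype.card V : ℝ)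

/-- The `ε`-mixing time. The infimum of the empty set would be `0`, so a lower bound on this
quantity never holds by default. -/
def mixingTime {Ω : Type*} [MeasurableSpace Ω] (P : V → MeasureTheory.Measure Ω)
    (η : ℝ≥0 → Ω → V) (ε : ℝ) : ℝ≥0 :=
  sInf {t : ℝ≥0 | ∀ x, tvDist (law P η x t) (uniform V) ≤ ε}

/-- The hitting time of `x`, equal to `∞` if `x` is never visited. -/
def hittingTime {V Ω : Type*} (η : ℝ≥0 → Ω → V) (x : V) (ω : Ω) : ℝ≥0∞ :=
  ⨅ (t : ℝ≥0) (_ : η t ω = x), (t : ℝ≥0∞)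

/-- The expected hitting time of `x` for the walk started from `y`. -/
def expectedHittingTime {Ω : Type*} [MeasurableSpace Ω] (P : V → MeasureTheory.Measure Ω)
    (η : ℝ≥0 → Ω → V) (y x : V) : ℝ≥0∞ :=
  ∫⁻ ω, hittingTime η x ω ∂(P y)

/-! ### Rooted trees -/

open scoped Classical in
/-- `ℓ(v)`: the edges on the shortest path from the root `o` to `v`. -/
def pathEdges (G : SimpleGraph V) (o v : V) : Finset (Sym2 V) :=
  {e | ∃ p : G.Walk o v, p.length = G.dist o v ∧ e ∈ p.edges}

open scoped Classical in
/-- The vertices of `T_v`: those joined to `v` inside `{u | dist o v ≤ dist o u}`. -/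
def subtreeVerts (G : SimpleGraph V) (o v : V) : Finset V :=
  {w | ∃ p : G.Walk v w, ∀ u ∈ p.support, G.dist o v ≤ G.dist o u}

open scoped Classical in
/-- The vertices of `T_e`, which is `T_v` for the endpoint `v` of `e` farther from the root. -/
def edgeSubtreeVerts (G : SimpleGraph V) (o : V) (e : Sym2 V) : Finset V :=
  {w | ∃ u v, e = s(u, v) ∧ G.dist o u < G.dist o v ∧ w ∈ subtreeVerts G o v}

/-- `x` is a `δ`-center of mass of `G`. -/
def IsCenterOfMass (G : SimpleGraph V) (δ : ℝ) (x : V) : Prop :=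
  ∃ T T' : G.Subgraph, T.coe.IsTree ∧ T'.coe.IsTree ∧
    T.verts ∩ T'.verts = {x} ∧ T.verts ∪ T'.verts = Set.univ ∧
    δ * (Fintype.card V : ℝ) ≤ (T.verts.ncard : ℝ) ∧
    δ * (Fintype.card V : ℝ) ≤ (T'.verts.ncard : ℝ)

end TreeWalk

end

/-! Upper bound on hitting times. Let `T`, `T'` be the two subtrees meeting at `o`, start in `T \
{o}`, and let `t` be a time at which the walk is mixed up to `ε / 2`. Since `T'` carries uniform
mass at least `ε`, from every vertex the walk is in `T \ {o}` at time `t` with probability at most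
`1 - ε / 2`. Until it hits `o` the walk cannot leave `T \ {o}`, so the probability of not having hit
`o` by time `k t` is at most `(1 - ε / 2) ^ k`. Summing the geometric series bounds the expected
hitting time by `2 t / ε`. The carriers are `not_adj_of_inter_eq_singleton`,
`measure_cross_eq_zero`, `stays_le_pow` and `expectedHittingTime_le`.

Lower bound on hitting times. The function `pathWeight` vanishes at `o` and has drift at least `-1`
elsewhere, because a subtree has at most one vertex more than its child subtrees together. Optional
stopping on a dyadic time grid then gives `pathWeight G o v ≤ E_v[τ]`
(`neg_one_le_generator_mulVec_pathWeight`, `le_expectedHittingTime`). This is stronger than the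
second inequality: the factor `1 / Δ` is only given away. -/

noncomputable section

namespace TreeWalk

/-! ### The transition semigroup and its limit -/

section Matrix

variable {V : Type*} [Fintype V]

open Filter Topology Matrix

variable [DecidableEq V] (G : SimpleGraph V) [DecidableRel G.Adj]

lemma generator_eq_neg_lapMatrix : generator G = -G.lapMatrix ℝ := by
  ext x y
  by_cases h : x = y
  · subst h; simp [generator, SimpleGraph.lapMatrix, SimpleGraph.degMatrix]
  · simp [generator, SimpleGraph.lapMatrix, SimpleGraph.degMatrix, h, SimpleGraph.adjMatrix_apply]

lemma generator_mulVec_apply (f : V → ℝ) (x : V) :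
    (generator G *ᵥ f) x = ∑ y ∈ G.neighborFinset x, (f y - f x) := by
  rw [generator_eq_neg_lapMatrix, neg_mulVec, Pi.neg_apply, SimpleGraph.lapMatrix_mulVec_apply]
  simp

lemma transition_zero : transition G 0 = 1 := by
  simp [transition, NormedSpace.exp_zero]

lemma hasDerivAt_transition_zero (x y : V) :
    HasDerivAt (fun t => transition G t x y) (generator G x y) 0 := by
  open scoped Matrix.Norms.Operator in
  have h := hasDerivAt_exp_smul_const (𝕂 := ℝ) (generator G) 0
  simp only [zero_smul, NormedSpace.exp_zero, one_mul] at h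
  exact hasDerivAt_pi.1 (hasDerivAt_pi.1 h x) y

/-- The generator annihilates constants, so only the zeroth term of the exponential series survives.
-/
lemma transition_mulVec_one (t : ℝ) : transition G t *ᵥ (fun _ => (1 : ℝ)) = fun _ => 1 := by
  open scoped Matrix.Norms.Operator in
  have hQ : (t • generator G) *ᵥ (fun _ => (1 : ℝ)) = 0 := by
    rw [smul_mulVec]
    ext x
    simp [generator_mulVec_apply]
  have h := NormedSpace.exp_series_hasSum_exp' (𝕂 := ℝ) (t • generator G)
  have h2 : HasSum (fun n : ℕ => ((n.factorial : ℝ)⁻¹ • (t • generator G) ^ n) *ᵥ fun _ => (1 : ℝ))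
      (transition G t *ᵥ fun _ => (1 : ℝ)) := by
    refine h.map (AddMonoidHom.mk' (fun A : Matrix V V ℝ => A *ᵥ fun _ => (1 : ℝ))
      fun A B => add_mulVec A B _) ?_
    exact Continuous.matrix_mulVec continuous_id continuous_const
  refine h2.unique ?_
  convert hasSum_single 0 ?_ using 1
  · simp
  · intro n hn
    obtain ⟨m, rfl⟩ := Nat.exists_eq_succ_of_ne_zero hn
    rw [pow_succ, smul_mulVec, ← mulVec_mulVec, hQ, mulVec_zero, smul_zero]

lemma sum_transition (t : ℝ) (x : V) : ∑ y, transition G t x y = 1 := by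
  simpa [mulVec, dotProduct] using congrFun (transition_mulVec_one G t) x

/-- The semigroup of a connected graph converges to a multiple of the all-ones matrix. -/
lemma exists_tendsto_transition (hG : G.Connected) :
    ∃ c : ℝ, ∀ x y, Tendsto (fun t => transition G t x y) atTop (𝓝 c) := by
  have hL : (G.lapMatrix ℝ).IsHermitian := G.isHermitian_lapMatrix ℝ
  have hpos : ∀ i, 0 ≤ hL.eigenvalues i :=
    (SimpleGraph.posSemidef_lapMatrix (R := ℝ) (G := G)).eigenvalues_nonneg
  set U : Matrix V V ℝ := (hL.eigenvectorUnitary : Matrix V V ℝ) with hU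
  have hUU : U * star U = 1 := Unitary.coe_mul_star_self _
  have hUinv : U⁻¹ = star U := inv_eq_right_inv hUU
  have hUunit : IsUnit U := (isUnit_iff_isUnit_det _).2 (isUnit_det_of_right_inverse hUU)
  have hspec : G.lapMatrix ℝ = U * diagonal hL.eigenvalues * U⁻¹ := by
    rw [hUinv]
    simpa using hL.spectral_theorem
  generalize hL.eigenvalues = l at hpos hspec
  have htr : ∀ t, transition G t =
      U * diagonal (fun i => Real.exp (-(t * l i))) * U⁻¹ := by
    intro t
    have : t • generator G = U * diagonal (fun i => -(t * l i)) * U⁻¹ := by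
      have h1 : diagonal (fun i => -(t * l i)) = -(t • diagonal l) := by
        rw [← diagonal_smul, ← diagonal_neg]; rfl
      rw [generator_eq_neg_lapMatrix, h1, Matrix.mul_neg, Matrix.neg_mul, Matrix.mul_smul,
        Matrix.smul_mul, ← hspec, smul_neg]
    rw [transition, this, exp_conj _ _ hUunit, exp_diagonal]
    congr 3
    ext i
    rw [Pi.coe_exp, Real.exp_eq_exp_ℝ]
  -- As `t → ∞`, `exp (-t l i)` tends to `1` if `l i = 0` and to `0` otherwise, so the limit is the
  -- projection onto the kernel of the Laplacian.
  set D : Matrix V V ℝ := diagonal (fun i => if l i = 0 then 1 else 0) with hD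
  have hlim : Tendsto (fun t => transition G t) atTop (𝓝 (U * D * U⁻¹)) := by
    simp_rw [htr]
    refine Tendsto.mul_const _ (Tendsto.const_mul _ ?_)
    suffices h : Tendsto (fun t i => Real.exp (-(t * l i))) atTop
        (𝓝 fun i => if l i = 0 then 1 else 0) from
      (Continuous.matrix_diagonal continuous_id).continuousAt.tendsto.comp h
    refine tendsto_pi_nhds.2 fun i => ?_
    by_cases h : l i = 0
    · simp [h]
    · have hi := lt_of_le_of_ne (hpos i) (Ne.symm h)
      simp only [h, if_false]
      exact Real.tendsto_exp_neg_atTop_nhds_zero.comp (tendsto_id.atTop_mul_const hi)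
  set M := U * D * U⁻¹ with hM
  have hLM : G.lapMatrix ℝ * M = 0 := by
    have h0 : diagonal l * D = 0 := by
      rw [hD, diagonal_mul_diagonal, ← diagonal_zero]
      congr 1
      ext i
      by_cases h : l i = 0 <;> simp [h]
    have h1 : U⁻¹ * U = 1 := nonsing_inv_mul _ ((isUnit_iff_isUnit_det _).1 hUunit)
    calc G.lapMatrix ℝ * M = U * diagonal l * (U⁻¹ * U) * D * U⁻¹ := by
          rw [hspec, hM]; simp only [Matrix.mul_assoc]
      _ = U * (diagonal l * D) * U⁻¹ := by
          rw [h1]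
          simp only [Matrix.mul_assoc, Matrix.mul_one]
      _ = 0 := by simp [h0]
  -- Columns of the limit lie in the kernel of the Laplacian, hence are constant on a connected
  -- graph; by symmetry a single constant remains.
  have hcol : ∀ x x' y, M x y = M x' y := by
    intro x x' y
    have : G.lapMatrix ℝ *ᵥ (fun z => M z y) = 0 := by
      ext z
      exact congrFun (congrFun hLM z) y
    exact ((SimpleGraph.lapMatrix_mulVec_eq_zero_iff_forall_reachable G).1 this) x x' (hG.preconnected x x')
  have hsymm : ∀ x y, M x y = M y x := by
    intro x y
    have hs : Mᵀ = M := by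
      rw [hM, hUinv]
      simp [hD, Matrix.mul_assoc, star_eq_conjTranspose]
    exact congrFun (congrFun hs y) x
  obtain ⟨o⟩ := hG.nonempty
  refine ⟨M o o, fun x y => ?_⟩
  have : M o o = M x y := by rw [hcol x o, hsymm o y, hcol y o]
  rw [this]
  exact (hlim.apply_nhds x).apply_nhds y

end Matrix

/-! ### Geodesics, subtrees and the drift of the path weight -/

section Tree

variable {V : Type*}

open SimpleGraph

variable {G : SimpleGraph V} {o : V}

lemma exists_geodesic_concat (hG : G.IsTree) {u w : V} (h : G.Adj u w)
    (hd : G.dist o u < G.dist o w) :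
    ∃ p : G.Walk o u, p.length = G.dist o u ∧ (p.concat h).length = G.dist o w := by
  obtain ⟨p, hp⟩ := hG.connected.exists_walk_length_eq_dist o u
  refine ⟨p, hp, le_antisymm ?_ (dist_le _)⟩
  rw [Walk.length_concat, hp]
  exact hd

lemma geodesic_unique (hG : G.IsTree) {u w : V} (p q : G.Walk u w)
    (hp : p.length = G.dist u w) (hq : q.length = G.dist u w) : p = q :=
  congrArg Subtype.val ((hG.isAcyclic.subsingleton_path u w).elim
    ⟨p, p.isPath_of_length_eq_dist hp⟩ ⟨q, q.isPath_of_length_eq_dist hq⟩)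

/-- Both geodesics extend to geodesics ending at `w`; these coincide, and so do their penultimate
vertices. -/
lemma parent_unique (hG : G.IsTree) {u u' w : V} (h : G.Adj u w) (h' : G.Adj u' w)
    (hd : G.dist o u < G.dist o w) (hd' : G.dist o u' < G.dist o w) : u = u' := by
  obtain ⟨p, -, hp⟩ := exists_geodesic_concat hG h hd
  obtain ⟨p', -, hp'⟩ := exists_geodesic_concat hG h' hd'
  have := congrArg Walk.penultimate (geodesic_unique hG _ _ hp hp')
  simpa using this

lemma exists_parent (hG : G.IsTree) {w : V} (hw : w ≠ o) :
    ∃ u, G.Adj u w ∧ G.dist o u < G.dist o w := by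
  obtain ⟨p, hp⟩ := hG.connected.exists_walk_length_eq_dist o w
  have hnil : ¬ p.Nil := Walk.not_nil_of_ne hw.symm
  refine ⟨p.penultimate, p.adj_penultimate hnil, ?_⟩
  have h1 := dist_le p.dropLast
  have h2 := hG.connected.pos_dist_of_ne hw.symm
  have h3 : p.dropLast.length + 1 = p.length := by
    simp [Walk.dropLast, Walk.take_length]; omega
  omega

/-- The parent is the only neighbour closer to the root, so a path avoiding it must first step away
from the root. Its next vertex has `x` as parent, which a path never revisits, and the argument
repeats. -/
lemma dist_le_of_mem_support_of_parent_notMem (hG : G.IsTree) {x z : V} (p : G.Walk x z) :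
    p.IsPath → ∀ u, G.Adj u x → G.dist o u < G.dist o x → u ∉ p.support →
      ∀ y ∈ p.support, G.dist o x ≤ G.dist o y := by
  induction p with
  | nil => simp
  | @cons x x' z h p ih =>
    intro hp u hu hd hup y hy
    rw [Walk.cons_isPath_iff] at hp
    simp only [Walk.support_cons, List.mem_cons, not_or] at hup hy
    have hlt : G.dist o x < G.dist o x' := by
      rcases lt_or_gt_of_ne (hG.dist_ne_of_adj o h) with h1 | h1
      · exact h1
      · have := parent_unique hG hu h.symm hd h1
        subst this
        exact absurd p.start_mem_support hup.2
    rcases hy with rfl | hy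
    · exact le_rfl
    · exact hlt.le.trans (ih hp.1 x h hlt hp.2 y hy)

/-- In a tree, two subtrees that share a single vertex are joined only through that vertex. -/
lemma not_adj_of_inter_eq_singleton (hG : G.IsTree) {T T' : G.Subgraph} (hT : T.coe.Connected)
    (hT' : T'.coe.Connected) (hi : T.verts ∩ T'.verts = {o}) {x y : V} (hx : x ∈ T.verts)
    (hy : y ∈ T'.verts) (hxo : x ≠ o) (hyo : y ≠ o) : ¬ G.Adj x y := by
  intro h
  have ho : o ∈ T.verts ∩ T'.verts := by rw [hi]; rfl
  have hxT' : x ∉ T'.verts := fun hx' => hxo (hi.subset ⟨hx, hx'⟩)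
  have hyT : y ∉ T.verts := fun hy' => hyo (hi.subset ⟨hy', hy⟩)
  have hwalk : ∀ {S : G.Subgraph} (hS : S.coe.Connected) {a b : V} (ha : a ∈ S.verts)
      (hb : b ∈ S.verts), ∃ p : G.Walk a b, ∀ z ∈ p.support, z ∈ S.verts := by
    intro S hS a b ha hb
    obtain ⟨p⟩ := hS.preconnected ⟨a, ha⟩ ⟨b, hb⟩
    refine ⟨p.map S.hom, fun z hz => ?_⟩
    obtain ⟨c, -, rfl⟩ := List.mem_map.1 ((congrArg (z ∈ ·) (Walk.support_map S.hom p)).mp hz)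
    exact c.2
  obtain ⟨p, hp⟩ := hwalk hT hx ho.1
  obtain ⟨q, hq⟩ := hwalk hT' ho.2 hy
  -- In a tree the edge `xy` would be a bridge, hence lie on the walk from `x` to `o` inside `T`
  -- followed by the walk from `o` to `y` inside `T'`. Either case puts an endpoint in the wrong
  -- subtree.
  have hb := isBridge_iff_forall_walk_mem_edges.1
    (isAcyclic_iff_forall_adj_isBridge.1 hG.isAcyclic h) (p.append q)
  rw [Walk.edges_append, List.mem_append] at hb
  rcases hb with h1 | h1
  · exact hyT (hp _ (p.snd_mem_support_of_mem_edges h1))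
  · exact hxT' (hq _ (q.fst_mem_support_of_mem_edges h1))

variable [Fintype V]

lemma mem_pathEdges {v : V} {e : Sym2 V} :
    e ∈ pathEdges G o v ↔ ∃ p : G.Walk o v, p.length = G.dist o v ∧ e ∈ p.edges := by
  simp [pathEdges]

lemma pathEdges_self : pathEdges G o o = ∅ := by
  ext e
  rw [mem_pathEdges]
  simp only [dist_self, Finset.notMem_empty, iff_false, not_exists, not_and]
  intro p hp
  rw [Walk.length_eq_zero_iff] at hp
  cases hp
  simp

lemma notMem_pathEdges {u w : V} (hd : G.dist o u < G.dist o w) :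
    s(u, w) ∉ pathEdges G o u := by
  classical
  rw [mem_pathEdges]
  rintro ⟨p, hp, he⟩
  have hw := p.snd_mem_support_of_mem_edges he
  have h1 := dist_le (p.takeUntil w hw)
  have h2 := p.length_takeUntil_le_length hw
  omega

lemma pathEdges_of_adj [DecidableEq V] (hG : G.IsTree) {u w : V} (h : G.Adj u w)
    (hd : G.dist o u < G.dist o w) :
    pathEdges G o w = insert s(u, w) (pathEdges G o u) := by
  obtain ⟨p, hp, hpc⟩ := exists_geodesic_concat hG h hd
  ext e
  simp only [Finset.mem_insert, mem_pathEdges]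
  constructor
  · rintro ⟨q, hq, he⟩
    rw [geodesic_unique hG q _ hq hpc, Walk.edges_concat] at he
    simp only [List.concat_eq_append, List.mem_append, List.mem_singleton] at he
    exact he.elim (fun he => Or.inr ⟨p, hp, he⟩) Or.inl
  · rintro (rfl | ⟨q, hq, he⟩)
    · exact ⟨_, hpc, by simp [Walk.edges_concat]⟩
    · rw [geodesic_unique hG q _ hq hp] at he
      exact ⟨_, hpc, by simp [Walk.edges_concat, he]⟩

lemma edgeSubtreeVerts_of_dist_lt {u w : V} (hd : G.dist o u < G.dist o w) :
    edgeSubtreeVerts G o s(u, w) = subtreeVerts G o w := by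
  ext z
  simp only [edgeSubtreeVerts, Finset.mem_filter, Finset.mem_univ, true_and]
  constructor
  · rintro ⟨a, b, he, hab, hz⟩
    rcases Sym2.eq_iff.1 he with ⟨rfl, rfl⟩ | ⟨rfl, rfl⟩
    · exact hz
    · omega
  · exact fun hz => ⟨u, w, rfl, hd, hz⟩

/-- A nontrivial path from `w` that never gets closer to `o` enters a child `c` first, and the rest
avoids `w`, the parent of `c`. Only this inclusion is needed, since the drift is bounded from one
side. -/
lemma subtreeVerts_subset [DecidableEq V] [DecidableRel G.Adj] (hG : G.IsTree) (w : V) :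
    subtreeVerts G o w ⊆ insert w
      (((G.neighborFinset w).filter fun c => G.dist o w < G.dist o c).biUnion
        (subtreeVerts G o)) := by
  intro z hz
  simp only [subtreeVerts, Finset.mem_filter, Finset.mem_univ, true_and] at hz
  obtain ⟨q, hq⟩ := hz
  have hq' : ∀ u ∈ q.bypass.support, G.dist o w ≤ G.dist o u :=
    fun u hu => hq u (q.support_bypass_subset_support hu)
  have hpath := q.bypass_isPath
  generalize q.bypass = p at hq' hpath
  cases p with
  | nil => simp
  | @cons _ c _ h p =>
    rw [Walk.cons_isPath_iff] at hpath
    have hlt : G.dist o w < G.dist o c :=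
      lt_of_le_of_ne (hq' c (by simp)) (hG.dist_ne_of_adj o h)
    refine Finset.mem_insert_of_mem (Finset.mem_biUnion.2 ⟨c, by simp [h, hlt], ?_⟩)
    simp only [subtreeVerts, Finset.mem_filter, Finset.mem_univ, true_and]
    exact ⟨p, dist_le_of_mem_support_of_parent_notMem hG p hpath.1 w h hlt hpath.2⟩

/-- The sum of the sizes of the subtrees hanging off the edges between the root and `v`; it
is the expected hitting time of the root from `v`. -/
def pathWeight (G : SimpleGraph V) (o v : V) : ℕ :=
  ∑ e ∈ pathEdges G o v, (edgeSubtreeVerts G o e).card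

lemma pathWeight_self : pathWeight G o o = 0 := by
  simp [pathWeight, pathEdges_self]

lemma pathWeight_of_adj (hG : G.IsTree) {u w : V} (h : G.Adj u w)
    (hd : G.dist o u < G.dist o w) :
    pathWeight G o w = pathWeight G o u + (subtreeVerts G o w).card := by
  classical
  rw [pathWeight, pathEdges_of_adj hG h hd, Finset.sum_insert (notMem_pathEdges hd),
    edgeSubtreeVerts_of_dist_lt hd, add_comm, pathWeight]

/-- A step to a child `c` raises the weight by `|T_c|`, the step to the parent lowers it by `|T_w|`,
and `|T_w| ≤ 1 + ∑ |T_c|`. -/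
lemma neg_one_le_generator_mulVec_pathWeight [DecidableEq V] [DecidableRel G.Adj] (hG : G.IsTree)
    {w : V} (hw : w ≠ o) :
    -1 ≤ (generator G).mulVec (fun v => (pathWeight G o v : ℝ)) w := by
  obtain ⟨u, hu, hd⟩ := exists_parent hG hw
  rw [generator_mulVec_apply, ← Finset.sum_filter_add_sum_filter_not _
    (fun c => G.dist o w < G.dist o c)]
  have hpar : (G.neighborFinset w).filter (fun c => ¬ G.dist o w < G.dist o c) = {u} := by
    ext c
    simp only [Finset.mem_filter, mem_neighborFinset, Finset.mem_singleton]
    constructor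
    · rintro ⟨h, hc⟩
      exact parent_unique hG h.symm hu
        (lt_of_le_of_ne (not_lt.1 hc) (hG.dist_ne_of_adj o h.symm)) hd
    · rintro rfl
      exact ⟨hu.symm, hd.not_gt⟩
  have hchild : ∀ c ∈ (G.neighborFinset w).filter (fun c => G.dist o w < G.dist o c),
      (pathWeight G o c : ℝ) - pathWeight G o w = (subtreeVerts G o c).card := by
    intro c hc
    simp only [Finset.mem_filter, mem_neighborFinset] at hc
    rw [pathWeight_of_adj hG hc.1 hc.2]
    push_cast; ring
  rw [hpar, Finset.sum_congr rfl hchild, Finset.sum_singleton, pathWeight_of_adj hG hu hd]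
  have hcard := ((Finset.card_le_card (subtreeVerts_subset (o := o) hG w)).trans
    (Finset.card_insert_le _ _)).trans (Nat.add_le_add_right Finset.card_biUnion_le 1)
  have : ((subtreeVerts G o w).card : ℝ) ≤ ∑ c ∈ (G.neighborFinset w).filter
      (fun c => G.dist o w < G.dist o c), ((subtreeVerts G o c).card : ℝ) + 1 := by
    exact_mod_cast hcard
  push_cast
  linarith

end Tree

/-! ### Law of the walk, convergence to equilibrium, Markov property on a time grid -/

section Markov

variable {V : Type*}

open Filter Topology MeasureTheory

variable {Ω : Type*} [MeasurableSpace Ω] {P : V → Measure Ω} {η : ℝ≥0 → Ω → V}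

/-- The event that the walk observed at times `0, s, …, k s` stays in `U`. -/
def stays (η : ℝ≥0 → Ω → V) (U : Set V) (s : ℝ≥0) (k : ℕ) : Set Ω :=
  {ω | ∀ j ≤ k, η (j * s) ω ∈ U}

/-- The mass function of the walk at time `k s`, killed when it is observed outside `U`. -/
def killedLaw (P : V → Measure Ω) (η : ℝ≥0 → Ω → V) (U : Set V) (s : ℝ≥0) (v : V) (k : ℕ) (x : V) :
    ℝ :=
  (P v).real (stays η U s k ∩ {ω | η (k * s) ω = x})

lemma killedLaw_nonneg (U : Set V) (s : ℝ≥0) (v : V) (k : ℕ) (x : V) :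
    0 ≤ killedLaw P η U s v k x := measureReal_nonneg

lemma killedLaw_of_notMem {U : Set V} (s : ℝ≥0) (v : V) (k : ℕ) {x : V} (hx : x ∉ U) :
    killedLaw P η U s v k x = 0 := by
  have : stays η U s k ∩ {ω | η (k * s) ω = x} = ∅ := by
    ext ω
    simp only [stays, Set.mem_inter_iff, Set.mem_ofPred_eq, Set.mem_empty_iff_false, iff_false,
      not_and]
    exact fun h1 h2 => hx (h2 ▸ h1 k le_rfl)
  simp [killedLaw, this]

variable [Fintype V] [DecidableEq V] {G : SimpleGraph V} [DecidableRel G.Adj]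

lemma IsSimpleRandomWalk.measure_eq (hη : IsSimpleRandomWalk G P η) (x : V) (t : ℝ≥0) (y : V) :
    P x {ω | η t ω = y} = ENNReal.ofReal (transition G t x y) := by
  simpa using hη.finiteDimensional x 0 (fun _ => t) monotone_const (fun _ => y)

lemma IsSimpleRandomWalk.law_eq_max (hη : IsSimpleRandomWalk G P η) (x : V) (t : ℝ≥0) (y : V) :
    law P η x t y = max (transition G t x y) 0 := by
  rw [law, Measure.real, hη.measure_eq, ENNReal.toReal_ofReal']

lemma IsSimpleRandomWalk.sum_law (hη : IsSimpleRandomWalk G P η) (x : V) (t : ℝ≥0) :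
    ∑ y, law P η x t y = 1 := by
  have := hη.isProbabilityMeasure x
  have h := sum_measureReal_preimage_singleton (μ := P x) (Finset.univ : Finset V) (f := η t)
    (fun y _ => hη.measurableSet t y)
  simp only [Finset.coe_univ, Set.preimage_univ, probReal_univ] at h
  exact h

/-- The probabilities are the positive parts of the entries. Both the entries of a row and their
positive parts sum to `1`, so no entry is negative. -/
lemma IsSimpleRandomWalk.transition_nonneg (hη : IsSimpleRandomWalk G P η) (x : V) (t : ℝ≥0)
    (y : V) : 0 ≤ transition G t x y := by
  have h1 : ∑ z, (max (transition G t x z) 0 - transition G t x z) = 0 := by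
    rw [Finset.sum_sub_distrib, sum_transition]
    simp_rw [← hη.law_eq_max, hη.sum_law, sub_self]
  have h2 := (Finset.sum_eq_zero_iff_of_nonneg
    (fun z _ => sub_nonneg.2 (le_max_left (transition G t x z) 0))).1 h1 y (Finset.mem_univ y)
  linarith [le_max_right (transition G t x y) 0]

lemma IsSimpleRandomWalk.law_eq (hη : IsSimpleRandomWalk G P η) (x : V) (t : ℝ≥0) (y : V) :
    law P η x t y = transition G t x y := by
  rw [hη.law_eq_max, max_eq_left (hη.transition_nonneg x t y)]

/-- Convergence to equilibrium. -/
lemma IsSimpleRandomWalk.tendsto_law (hη : IsSimpleRandomWalk G P η) (hG : G.Connected) (x y : V) :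
    Tendsto (fun t => law P η x t y) atTop (𝓝 (uniform V y)) := by
  obtain ⟨c, hc⟩ := exists_tendsto_transition G hG
  have hlim : ∀ y, Tendsto (fun t => law P η x t y) atTop (𝓝 c) := fun y => by
    simp_rw [hη.law_eq]
    exact (hc x y).comp (NNReal.tendsto_coe_atTop.2 tendsto_id)
  have hsum : Tendsto (fun t => ∑ y, law P η x t y) atTop (𝓝 (∑ _y : V, c)) :=
    tendsto_finsetSum _ fun y _ => hlim y
  simp_rw [hη.sum_law] at hsum
  -- The common limit `c` satisfies `|V| c = 1` because total mass is preserved.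
  have h1 := tendsto_nhds_unique hsum tendsto_const_nhds
  have : c = uniform V y := by
    have := hG.nonempty
    have hn : (Fintype.card V : ℝ) ≠ 0 := by
      exact_mod_cast Fintype.card_ne_zero
    rw [uniform, eq_div_iff hn, mul_comm]
    simpa using h1
  exact this ▸ hlim y

lemma IsSimpleRandomWalk.exists_tvDist_le (hη : IsSimpleRandomWalk G P η) (hG : G.Connected)
    {ε : ℝ} (hε : 0 < ε) : ∃ t, ∀ x, tvDist (law P η x t) (uniform V) ≤ ε := by
  suffices h : ∀ x, ∀ A : Finset V, ∀ᶠ t in atTop,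
      |∑ a ∈ A, law P η x t a - ∑ a ∈ A, uniform V a| ≤ ε by
    obtain ⟨t, ht⟩ := (eventually_all.2 fun x => eventually_all.2 (h x)).exists
    exact ⟨t, fun x => Finset.sup'_le _ _ fun A _ => ht x A⟩
  intro x A
  have h : Tendsto (fun t => |∑ a ∈ A, law P η x t a - ∑ a ∈ A, uniform V a|) atTop (𝓝 0) := by
    have := ((tendsto_finsetSum A fun a _ => hη.tendsto_law hG x a).sub_const
      (∑ a ∈ A, uniform V a)).abs
    simpa using this
  exact (h.eventually_lt_const hε).mono fun _ h => h.le

lemma IsSimpleRandomWalk.measurable (hη : IsSimpleRandomWalk G P η) (t : ℝ≥0) :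
    Measurable[_, ⊤] (η t) :=
  letI : MeasurableSpace V := ⊤
  measurable_to_countable' (hη.measurableSet t)

lemma IsSimpleRandomWalk.measurableSet_stays (hη : IsSimpleRandomWalk G P η) (U : Set V)
    (s : ℝ≥0) (k : ℕ) : MeasurableSet (stays η U s k) := by
  have : stays η U s k = ⋂ j ≤ k, η (j * s) ⁻¹' U := by ext; simp [stays]
  rw [this]
  exact MeasurableSet.iInter fun j => MeasurableSet.iInter fun _ => hη.measurable _ trivial

/-- Appending `y` to `z` gives a cylinder with one more time, whose product formula has one extra
last factor. -/
lemma IsSimpleRandomWalk.measure_cylinder_step (hη : IsSimpleRandomWalk G P η) (v : V) (s : ℝ≥0)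
    (k : ℕ) (z : Fin (k + 1) → V) (y : V) :
    P v ({ω | ∀ i : Fin (k + 1), η ((i : ℕ) * s) ω = z i} ∩ {ω | η ((k + 1 : ℕ) * s) ω = y}) =
      P v {ω | ∀ i : Fin (k + 1), η ((i : ℕ) * s) ω = z i} *
        ENNReal.ofReal (transition G s (z (Fin.last k)) y) := by
  have hmono : ∀ n : ℕ, Monotone fun i : Fin (n + 1) => ((i : ℕ) : ℝ≥0) * s := by
    intro n i j hij
    have : (i : ℕ) ≤ j := hij
    dsimp only
    gcongr
  have hset : {ω | ∀ i : Fin (k + 1), η ((i : ℕ) * s) ω = z i} ∩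
      {ω | η ((k + 1 : ℕ) * s) ω = y} =
      {ω | ∀ i : Fin (k + 1 + 1), η ((i : ℕ) * s) ω = Fin.snoc (α := fun _ => V) z y i} := by
    ext ω
    simp [Fin.forall_fin_succ']
  have hstep : ∀ n : ℕ, ∀ i : Fin n,
      (((((i.succ : Fin (n + 1)) : ℕ) : ℝ≥0) * s : ℝ≥0) : ℝ) -
        (((((i.castSucc : Fin (n + 1)) : ℕ) : ℝ≥0) * s : ℝ≥0) : ℝ) = s := by
    intro n i
    push_cast [Fin.val_succ, Fin.val_castSucc]
    ring
  rw [hset, hη.finiteDimensional v (k + 1) _ (hmono _), hη.finiteDimensional v k _ (hmono _)]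
  simp_rw [hstep]
  rw [← ENNReal.ofReal_mul (mul_nonneg (hη.transition_nonneg _ _ _)
    (Finset.prod_nonneg fun i _ => hη.transition_nonneg _ _ _)), Fin.prod_univ_castSucc]
  congr 1
  have h0 : (0 : Fin (k + 1 + 1)) = Fin.castSucc 0 := rfl
  simp only [← Fin.castSucc_succ, Fin.snoc_castSucc, Fin.succ_last, Fin.snoc_last, h0,
    Fin.val_castSucc]
  ring

/-- The Markov property of the walk observed at times `0, s, 2 s, …`. -/
lemma IsSimpleRandomWalk.measure_stays_step (hη : IsSimpleRandomWalk G P η) (v : V) (U : Set V)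
    (s : ℝ≥0) (k : ℕ) (x y : V) :
    P v (stays η U s k ∩ {ω | η (k * s) ω = x} ∩ {ω | η ((k + 1 : ℕ) * s) ω = y}) =
      P v (stays η U s k ∩ {ω | η (k * s) ω = x}) * ENNReal.ofReal (transition G s x y) := by
  classical
  set Z : Ω → Fin (k + 1) → V := fun ω i => η ((i : ℕ) * s) ω with hZ
  set F : Finset (Fin (k + 1) → V) := {z | (∀ i, z i ∈ U) ∧ z (Fin.last k) = x} with hF
  have hpre : ∀ z, Z ⁻¹' {z} = {ω | ∀ i : Fin (k + 1), η ((i : ℕ) * s) ω = z i} := by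
    intro z; ext ω; simp [hZ, funext_iff]
  have hmeas : ∀ z, MeasurableSet (Z ⁻¹' {z}) := by
    intro z
    rw [hpre, Set.ofPred_forall]
    exact MeasurableSet.iInter fun i => hη.measurableSet _ _
  have hstay : stays η U s k ∩ {ω | η (k * s) ω = x} = Z ⁻¹' F := by
    ext ω
    simp [stays, hF, hZ, Fin.forall_iff]
  have hB := hη.measurableSet ((k + 1 : ℕ) * s) y
  rw [hstay, ← Measure.restrict_apply' hB,
    ← sum_measure_preimage_singleton F (fun z _ => hmeas z),
    ← sum_measure_preimage_singleton F (fun z _ => hmeas z), Finset.sum_mul]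
  refine Finset.sum_congr rfl fun z hz => ?_
  rw [Measure.restrict_apply' hB, hpre, hη.measure_cylinder_step]
  have : z (Fin.last k) = x := by simp [hF] at hz; exact hz.2
  rw [this]

lemma IsSimpleRandomWalk.sum_killedLaw (hη : IsSimpleRandomWalk G P η) (U : Set V) (s : ℝ≥0)
    (v : V) (k : ℕ) : ∑ x, killedLaw P η U s v k x = (P v).real (stays η U s k) := by
  have := hη.isProbabilityMeasure v
  have h := sum_measureReal_preimage_singleton (μ := (P v).restrict (stays η U s k))
    (Finset.univ : Finset V) (f := η (k * s)) (fun y _ => hη.measurableSet _ y)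
  simp only [measureReal_restrict_apply' (hη.measurableSet_stays U s k), Finset.coe_univ,
    Set.preimage_univ, Set.univ_inter] at h
  rw [← h]
  exact Finset.sum_congr rfl fun x _ => by rw [Set.inter_comm]; rfl

lemma IsSimpleRandomWalk.killedLaw_succ (hη : IsSimpleRandomWalk G P η) {U : Set V} (s : ℝ≥0)
    (v : V) (k : ℕ) {y : V} (hy : y ∈ U) :
    killedLaw P η U s v (k + 1) y = ∑ x, killedLaw P η U s v k x * transition G s x y := by
  have := hη.isProbabilityMeasure v
  set A : Set Ω := stays η U s k ∩ {ω | η ((k + 1 : ℕ) * s) ω = y}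
  have hA : MeasurableSet A := (hη.measurableSet_stays U s k).inter (hη.measurableSet _ _)
  have hset : stays η U s (k + 1) ∩ {ω | η ((k + 1 : ℕ) * s) ω = y} = A := by
    ext ω
    simp only [A, stays, Set.mem_inter_iff, Set.mem_ofPred_eq]
    constructor
    · exact fun h => ⟨fun j hj => h.1 j (hj.trans k.le_succ), h.2⟩
    · refine fun h => ⟨fun j hj => ?_, h.2⟩
      rcases Nat.le_succ_iff.1 hj with hj | rfl
      · exact h.1 j hj
      · rw [h.2]; exact hy
  have h := sum_measureReal_preimage_singleton (μ := (P v).restrict A)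
    (Finset.univ : Finset V) (f := η (k * s)) (fun y _ => hη.measurableSet _ y)
  simp only [measureReal_restrict_apply' hA, Finset.coe_univ,
    Set.preimage_univ, Set.univ_inter] at h
  rw [killedLaw, hset, ← h]
  refine Finset.sum_congr rfl fun x _ => ?_
  have h2 : η (k * s) ⁻¹' {x} ∩ A =
      stays η U s k ∩ {ω | η (k * s) ω = x} ∩ {ω | η ((k + 1 : ℕ) * s) ω = y} := by
    ext ω
    simp only [A, Set.mem_inter_iff, Set.mem_preimage, Set.mem_singleton_iff, Set.mem_ofPred_eq]
    tauto
  rw [h2, Measure.real, hη.measure_stays_step, ENNReal.toReal_mul,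
    ENNReal.toReal_ofReal (hη.transition_nonneg _ _ _)]
  rfl

lemma IsSimpleRandomWalk.killedLaw_zero (hη : IsSimpleRandomWalk G P η) {U : Set V} (s : ℝ≥0)
    {v : V} (hv : v ∈ U) (x : V) :
    killedLaw P η U s v 0 x = if x = v then 1 else 0 := by
  classical
  have : stays η U s 0 ∩ {ω | η ((0 : ℕ) * s) ω = x} = if x ∈ U then {ω | η 0 ω = x} else ∅ := by
    split_ifs with h <;> ext ω <;> simp [stays] <;> grind
  have h := hη.law_eq v 0 x
  rw [law] at h
  rw [killedLaw, this]
  split_ifs with h1 h2 h2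
  · rw [h, h2]; simp [transition_zero]
  · rw [h]; simp [transition_zero, Ne.symm h2]
  · exact absurd (h2 ▸ hv) h1
  · simp

end Markov

/-! ### Upper bound for hitting times -/

section Hitting

variable {V : Type*}

open Filter Topology MeasureTheory

variable {Ω : Type*} {η : ℝ≥0 → Ω → V} {o : V}

lemma hittingTime_lt_iff {ω : Ω} {a : ℝ≥0∞} :
    hittingTime η o ω < a ↔ ∃ t : ℝ≥0, η t ω = o ∧ (t : ℝ≥0∞) < a := by
  simp [hittingTime, iInf_lt_iff]

lemma ne_of_lt_hittingTime {ω : Ω} {t : ℝ≥0} (h : (t : ℝ≥0∞) < hittingTime η o ω) :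
    η t ω ≠ o :=
  fun h' => h.not_ge (iInf₂_le t h')

/-- A right-continuous path that visits `o` before time `a` does so at dyadic times. -/
lemma eventually_exists_dyadic_hit {ω : Ω}
    (hω : ∀ t, ∀ᶠ s in 𝓝[≥] t, η s ω = η t ω) {t a : ℝ≥0} (ht : η t ω = o) (hta : t < a) :
    ∀ᶠ n : ℕ in atTop, ∃ j : ℕ, j * (2⁻¹ : ℝ≥0) ^ n < a ∧ η (j * (2⁻¹ : ℝ≥0) ^ n) ω = o := by
  set d : ℕ → ℝ≥0 := fun n => (2⁻¹ : ℝ≥0) ^ n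
  have hd : ∀ n, 0 < d n := fun n => by positivity
  set q : ℕ → ℝ≥0 := fun n => ⌈t / d n⌉₊ * d n
  -- Rounding up makes the dyadic times approach `t` from the right, where the path is continuous.
  have hle : ∀ n, t ≤ q n := fun n => (div_le_iff₀ (hd n)).1 (Nat.le_ceil _)
  have hlt : ∀ n, q n ≤ t + d n := by
    intro n
    have h1 := (Nat.ceil_lt_add_one (zero_le : 0 ≤ t / d n)).le
    calc q n ≤ (t / d n + 1) * d n := mul_le_mul_left h1 _
      _ = t + d n := by rw [add_mul, div_mul_cancel₀ _ (hd n).ne', one_mul]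
  have hd0 : Tendsto d atTop (𝓝 0) := by
    refine tendsto_pow_atTop_nhds_zero_of_lt_one zero_le ?_
    exact inv_lt_one_of_one_lt₀ one_lt_two
  have hq : Tendsto q atTop (𝓝 t) := by
    refine tendsto_of_tendsto_of_tendsto_of_le_of_le tendsto_const_nhds ?_ hle hlt
    simpa using hd0.const_add t
  have hq' : Tendsto q atTop (𝓝[≥] t) :=
    tendsto_nhdsWithin_of_tendsto_nhds_of_eventually_within _ hq (Eventually.of_forall hle)
  filter_upwards [hq'.eventually (hω t), hq.eventually_lt_const hta] with n h1 h2
  exact ⟨⌈t / d n⌉₊, h2, h1.trans ht⟩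

variable [MeasurableSpace Ω] {P : V → Measure Ω}
variable [Fintype V] [DecidableEq V] {G : SimpleGraph V} [DecidableRel G.Adj]

lemma IsSimpleRandomWalk.measurable_hittingTime (hη : IsSimpleRandomWalk G P η) (o : V) :
    Measurable (hittingTime η o) := by
  refine measurable_of_Iio fun a => ?_
  have : hittingTime η o ⁻¹' Set.Iio a = ⋃ (n : ℕ) (j : ℕ)
      (_ : ((j * (2⁻¹ : ℝ≥0) ^ n : ℝ≥0) : ℝ≥0∞) < a), {ω | η (j * (2⁻¹ : ℝ≥0) ^ n) ω = o} := by
    ext ω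
    simp only [Set.mem_preimage, Set.mem_Iio, hittingTime_lt_iff, Set.mem_iUnion,
      Set.mem_ofPred_eq]
    constructor
    · rintro ⟨t, ht, hta⟩
      obtain ⟨b, htb, hba⟩ := ENNReal.lt_iff_exists_nnreal_btwn.1 hta
      obtain ⟨n, j, hj, hjo⟩ := (eventually_exists_dyadic_hit (hη.rightContinuous ω) ht
        (ENNReal.coe_lt_coe.1 htb)).exists
      exact ⟨n, j, (ENNReal.coe_lt_coe.2 hj).trans hba, hjo⟩
    · rintro ⟨n, j, hj, hjo⟩
      exact ⟨_, hjo, hj⟩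
  rw [this]
  exact MeasurableSet.iUnion fun n => MeasurableSet.iUnion fun j => MeasurableSet.iUnion fun _ =>
    hη.measurableSet _ _

lemma IsSimpleRandomWalk.measure_start_ne (hη : IsSimpleRandomWalk G P η) (v : V) :
    P v {ω | η 0 ω ≠ v} = 0 := by
  have := hη.isProbabilityMeasure v
  exact (prob_compl_eq_zero_iff (hη.measurableSet 0 v)).2 (hη.start v)

lemma IsSimpleRandomWalk.measure_step_le (hη : IsSimpleRandomWalk G P η) (v : V) (s : ℝ≥0)
    (k : ℕ) (x y : V) :
    P v ({ω | η (k * s) ω = x} ∩ {ω | η ((k + 1 : ℕ) * s) ω = y}) ≤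
      ENNReal.ofReal (transition G s x y) := by
  have := hη.isProbabilityMeasure v
  have h := hη.measure_stays_step v Set.univ s k x y
  have hu : stays η Set.univ s k = Set.univ := by ext; simp [stays]
  rw [hu, Set.univ_inter] at h
  rw [h]
  exact mul_le_of_le_one_left' prob_le_one

/-- The derivative of the transition probability at time `0` is the generator entry, which vanishes
for distinct nonadjacent vertices. Hence `N` steps of length `b / N` contribute `o(1)`. -/
lemma tendsto_nsmul_transition_div {x y : V} (hne : x ≠ y) (hadj : ¬ G.Adj x y) (b : ℝ) :
    Tendsto (fun N : ℕ => (N : ℝ) * transition G (b / N) x y) atTop (𝓝 0) := by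
  have h := hasDerivAt_transition_zero G x y
  have h0 : generator G x y = 0 := by simp [generator, hne, hadj]
  rw [h0] at h
  have h1 := h.hasFDerivAt.lim b (c := fun N : ℕ => (N : ℝ)) (l := atTop)
    (by simpa using tendsto_natCast_atTop_atTop)
  simpa [transition_zero, hne, div_eq_inv_mul] using h1

/-- The walk cannot pass from `U` to `W` without visiting `o` if no edge joins `U` to `W`. -/
lemma IsSimpleRandomWalk.measure_cross_eq_zero (hη : IsSimpleRandomWalk G P η) {U W : Set V}
    (hUW : Disjoint U W) (hadj : ∀ x ∈ U, ∀ y ∈ W, ¬ G.Adj x y)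
    (hcover : ∀ x, x ≠ o → x ∈ U ∨ x ∈ W) {v : V} (hv : v ∈ U) (b : ℝ≥0) :
    P v {ω | η b ω ∈ W ∧ (b : ℝ≥0∞) < hittingTime η o ω} = 0 := by
  classical
  set E : Set Ω := {ω | η b ω ∈ W ∧ (b : ℝ≥0∞) < hittingTime η o ω}
  set I : Finset (V × V) := {p | p.1 ∈ U ∧ p.2 ∈ W} with hI
  have hbound : ∀ N : ℕ, 1 ≤ N →
      P v E ≤ ENNReal.ofReal (∑ p ∈ I, (N : ℝ) * transition G (b / N) p.1 p.2) := by
    intro N hN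
    set s : ℝ≥0 := b / N with hs
    have hNs : N * s = b := mul_div_cancel₀ _ (by positivity)
    -- A walk starting at `v`, avoiding `o` and in `W` at time `b` must jump directly from `U` to
    -- `W` in some grid step.
    have hsub : E ⊆ {ω | η 0 ω ≠ v} ∪ ⋃ p ∈ I, ⋃ i ∈ Finset.range N,
        ({ω | η (i * s) ω = p.1} ∩ {ω | η ((i + 1 : ℕ) * s) ω = p.2}) := by
      rintro ω ⟨hW, hτ⟩
      by_contra hcon
      simp only [Set.mem_union, Set.mem_iUnion, not_or, not_exists, Set.mem_ofPred_eq,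
        Set.mem_inter_iff, not_not, Finset.mem_range, hI, Finset.mem_filter, Finset.mem_univ,
        true_and] at hcon
      obtain ⟨h0, hcon⟩ := hcon
      have hall : ∀ i ≤ N, η (i * s) ω ∈ U := by
        intro i
        induction i with
        | zero => intro _; simpa [h0] using hv
        | succ i ih =>
          intro hi
          have hiU := ih (by omega)
          have hlt : (((i + 1 : ℕ) * s : ℝ≥0) : ℝ≥0∞) < hittingTime η o ω := by
            refine lt_of_le_of_lt (ENNReal.coe_le_coe.2 ?_) hτ
            rw [← hNs]
            gcongr
          refine (hcover _ (ne_of_lt_hittingTime hlt)).resolve_right fun hiW => ?_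
          exact hcon (η (i * s) ω, η ((i + 1 : ℕ) * s) ω) ⟨hiU, hiW⟩ i (by omega) ⟨rfl, rfl⟩
      have := hall N le_rfl
      rw [hNs] at this
      exact Set.disjoint_left.1 hUW this hW
    have hnn : ∀ x y, 0 ≤ transition G (b / N) x y := fun x y => by
      simpa [hs] using hη.transition_nonneg x s y
    calc P v E ≤ _ := measure_mono hsub
      _ ≤ P v {ω | η 0 ω ≠ v} + P v (⋃ p ∈ I, ⋃ i ∈ Finset.range N,
        ({ω | η (i * s) ω = p.1} ∩ {ω | η ((i + 1 : ℕ) * s) ω = p.2})) := measure_union_le _ _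
      _ ≤ 0 + ∑ p ∈ I, ∑ i ∈ Finset.range N, ENNReal.ofReal (transition G s p.1 p.2) := by
        rw [hη.measure_start_ne]
        gcongr
        refine (measure_biUnion_finset_le _ _).trans (Finset.sum_le_sum fun p _ => ?_)
        refine (measure_biUnion_finset_le _ _).trans (Finset.sum_le_sum fun i _ => ?_)
        exact hη.measure_step_le v s i p.1 p.2
      _ = _ := by
        rw [zero_add, ENNReal.ofReal_sum_of_nonneg
          fun p _ => mul_nonneg (Nat.cast_nonneg N) (hnn _ _)]
        refine Finset.sum_congr rfl fun p _ => ?_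
        rw [Finset.sum_const, Finset.card_range, nsmul_eq_mul,
          ENNReal.ofReal_mul (Nat.cast_nonneg N), ENNReal.ofReal_natCast]
        simp [hs]
  have hlim : Tendsto (fun N : ℕ => ENNReal.ofReal
      (∑ p ∈ I, (N : ℝ) * transition G (b / N) p.1 p.2)) atTop (𝓝 0) := by
    rw [← ENNReal.ofReal_zero, ← Finset.sum_const_zero (s := I) (ι := V × V)]
    refine ENNReal.tendsto_ofReal (tendsto_finsetSum _ fun p hp => ?_)
    simp only [hI, Finset.mem_filter, Finset.mem_univ, true_and] at hp
    exact tendsto_nsmul_transition_div (hUW.ne_of_mem hp.1 hp.2)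
      (hadj _ hp.1 _ hp.2) b
  exact le_antisymm (ge_of_tendsto hlim (eventually_atTop.2 ⟨1, hbound⟩)) zero_le

/-- Each grid step retains at most the fraction `c` of the killed mass. -/
lemma IsSimpleRandomWalk.stays_le_pow (hη : IsSimpleRandomWalk G P η) {U : Set V} {t : ℝ≥0}
    {c : ℝ} (hc : 0 ≤ c) [DecidablePred (· ∈ U)]
    (hU : ∀ x ∈ U, ∑ y with y ∈ U, transition G t x y ≤ c)
    (v : V) (k : ℕ) : (P v).real (stays η U t k) ≤ c ^ k := by
  have := hη.isProbabilityMeasure v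
  induction k with
  | zero => simp
  | succ k ih =>
    have h1 : (P v).real (stays η U t (k + 1)) =
        ∑ y with y ∈ U, killedLaw P η U t v (k + 1) y := by
      rw [← hη.sum_killedLaw, Finset.sum_filter]
      exact Finset.sum_congr rfl fun y _ => by
        split_ifs with h
        · rfl
        · exact killedLaw_of_notMem t v _ h
    calc (P v).real (stays η U t (k + 1))
        = ∑ y with y ∈ U, ∑ x, killedLaw P η U t v k x * transition G t x y := by
          rw [h1]
          exact Finset.sum_congr rfl fun y hy => hη.killedLaw_succ t v k (by simpa using hy)
      _ = ∑ x, killedLaw P η U t v k x * ∑ y with y ∈ U, transition G t x y := by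
          rw [Finset.sum_comm]; simp_rw [Finset.mul_sum]
      _ ≤ ∑ x, killedLaw P η U t v k x * c := by
          refine Finset.sum_le_sum fun x _ => ?_
          by_cases hx : x ∈ U
          · exact mul_le_mul_of_nonneg_left (hU x hx) (killedLaw_nonneg _ _ _ _ _)
          · simp [killedLaw_of_notMem t v k hx]
      _ = (P v).real (stays η U t k) * c := by rw [← Finset.sum_mul, hη.sum_killedLaw]
      _ ≤ c ^ (k + 1) := by rw [pow_succ]; exact mul_le_mul_of_nonneg_right ih hc

/-- A nonnegative quantity is at most the sum of the lengths of the intervals `[k t, (k + 1) t]`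
that it meets. -/
lemma le_tsum_ite {t : ℝ≥0} (ht : 0 < t) (τ : ℝ≥0∞) :
    τ ≤ ∑' k : ℕ, if ((k * t : ℝ≥0) : ℝ≥0∞) < τ then (t : ℝ≥0∞) else 0 := by
  have hfin : ∀ N : ℕ, min τ ((N * t : ℝ≥0) : ℝ≥0∞) ≤
      ∑ k ∈ Finset.range N, if ((k * t : ℝ≥0) : ℝ≥0∞) < τ then (t : ℝ≥0∞) else 0 := by
    intro N
    induction N with
    | zero => simp
    | succ N ih =>
      rw [Finset.sum_range_succ]
      split_ifs with h
      · rw [min_eq_right h.le] at ih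
        refine (min_le_right _ _).trans ?_
        refine le_trans (le_of_eq ?_) (add_le_add_left ih _)
        push_cast; ring
      · rw [min_eq_left (not_lt.1 h)] at ih
        exact (min_le_left _ _).trans (by simpa using ih)
  refine le_of_forall_lt fun a ha => ?_
  obtain ⟨b, hab, hb⟩ := ENNReal.lt_iff_exists_nnreal_btwn.1 ha
  obtain ⟨N, hN⟩ := exists_nat_gt (b / t)
  have hN' : b ≤ N * t := ((div_lt_iff₀ ht).1 hN).le
  exact hab.trans_le ((le_min hb.le (ENNReal.coe_le_coe.2 hN')).trans
    ((hfin N).trans (ENNReal.sum_le_tsum _)))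

/-- If the chain observed at time `t` leaves `U` with probability at least `1 - c`, and `U` can be
left only through `o`, then the expected hitting time of `o` is at most `t / (1 - c)`. -/
lemma IsSimpleRandomWalk.expectedHittingTime_le (hη : IsSimpleRandomWalk G P η) {U W : Set V}
    [DecidablePred (· ∈ U)]
    (hUW : Disjoint U W) (hadj : ∀ x ∈ U, ∀ y ∈ W, ¬ G.Adj x y)
    (hcover : ∀ x, x ≠ o → x ∈ U ∨ x ∈ W) {v : V} (hv : v ∈ U) {t : ℝ≥0} (ht : 0 < t) {c : ℝ}
    (hU : ∀ x ∈ U, ∑ y with y ∈ U, transition G t x y ≤ c) :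
    expectedHittingTime P η v o ≤ t * (ENNReal.ofReal (1 - c))⁻¹ := by
  have := hη.isProbabilityMeasure v
  have hc0 : 0 ≤ c := (Finset.sum_nonneg fun y _ => hη.transition_nonneg v t y).trans (hU v hv)
  have hτ := hη.measurable_hittingTime o
  have htail : ∀ k : ℕ, P v {ω | ((k * t : ℝ≥0) : ℝ≥0∞) < hittingTime η o ω} ≤
      ENNReal.ofReal c ^ k := by
    intro k
    -- Before `o` is hit, every observation lies in `U` or in `W`; the latter has probability zero.
    have hsub : {ω | ((k * t : ℝ≥0) : ℝ≥0∞) < hittingTime η o ω} ⊆ stays η U t k ∪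
        ⋃ j : ℕ, {ω | η (j * t) ω ∈ W ∧ ((j * t : ℝ≥0) : ℝ≥0∞) < hittingTime η o ω} := by
      intro ω hω
      by_contra hcon
      simp only [Set.mem_union, Set.mem_iUnion, not_or, not_exists, Set.mem_ofPred_eq, not_and] at hcon
      refine hcon.1 fun j hj => ?_
      have hlt : ((j * t : ℝ≥0) : ℝ≥0∞) < hittingTime η o ω := by
        refine lt_of_le_of_lt (ENNReal.coe_le_coe.2 ?_) hω
        gcongr
      exact (hcover _ (ne_of_lt_hittingTime hlt)).resolve_right fun h => hcon.2 j h hlt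
    calc _ ≤ _ := measure_mono hsub
      _ ≤ P v (stays η U t k) + 0 := by
        refine (measure_union_le _ _).trans (add_le_add le_rfl (le_of_eq ?_))
        exact measure_iUnion_null fun j => hη.measure_cross_eq_zero hUW hadj hcover hv _
      _ ≤ ENNReal.ofReal c ^ k := by
        rw [add_zero, ← ENNReal.ofReal_pow hc0, ← ofReal_measureReal]
        exact ENNReal.ofReal_le_ofReal (hη.stays_le_pow hc0 hU v k)
  have hind : ∀ k : ℕ, MeasurableSet {ω | ((k * t : ℝ≥0) : ℝ≥0∞) < hittingTime η o ω} :=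
    fun k => measurableSet_lt measurable_const hτ
  calc expectedHittingTime P η v o
      ≤ ∫⁻ ω, ∑' k : ℕ, {ω | ((k * t : ℝ≥0) : ℝ≥0∞) < hittingTime η o ω}.indicator
          (fun _ => (t : ℝ≥0∞)) ω ∂(P v) := lintegral_mono fun ω => by
        simp only [Set.indicator_apply, Set.mem_ofPred_eq]
        exact le_tsum_ite ht (hittingTime η o ω)
    _ = ∑' k : ℕ, t * P v {ω | ((k * t : ℝ≥0) : ℝ≥0∞) < hittingTime η o ω} := by
        rw [lintegral_tsum fun k => (measurable_const.indicator (hind k)).aemeasurable]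
        simp_rw [lintegral_indicator_const (hind _)]
    _ ≤ ∑' k : ℕ, t * ENNReal.ofReal c ^ k :=
        ENNReal.tsum_le_tsum fun k => mul_le_mul_right (htail k) _
    _ = t * (ENNReal.ofReal (1 - c))⁻¹ := by
        rw [ENNReal.tsum_mul_left, ENNReal.tsum_geometric, ENNReal.ofReal_sub _ hc0,
          ENNReal.ofReal_one]

end Hitting

/-! ### Lower bound for hitting times by optional stopping -/

section LowerBound

variable {V : Type*}

open Filter Topology MeasureTheory

variable {Ω : Type*} {η : ℝ≥0 → Ω → V} {o : V}

/-- The time, up to `K s`, during which the walk observed at multiples of `s` has not visited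
`o`. -/
def gridTime (η : ℝ≥0 → Ω → V) (o : V) (s : ℝ≥0) (K : ℕ) (ω : Ω) : ℝ≥0∞ :=
  ∑ k ∈ Finset.range K, (stays η {o}ᶜ s k).indicator (fun _ => (s : ℝ≥0∞)) ω

lemma gridTime_le (s : ℝ≥0) (K : ℕ) (ω : Ω) : gridTime η o s K ω ≤ ((K * s : ℝ≥0) : ℝ≥0∞) := by
  calc gridTime η o s K ω ≤ ∑ k ∈ Finset.range K, (s : ℝ≥0∞) :=
        Finset.sum_le_sum fun k _ => Set.indicator_le_self' (fun _ _ => zero_le) ω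
    _ = _ := by simp

lemma gridTime_le_of_hit {s : ℝ≥0} {ω : Ω} {j : ℕ} (hj : η (j * s) ω = o) (K : ℕ) :
    gridTime η o s K ω ≤ ((j * s : ℝ≥0) : ℝ≥0∞) := by
  have hzero : ∀ k, j ≤ k → (stays η {o}ᶜ s k).indicator (fun _ => (s : ℝ≥0∞)) ω = 0 :=
    fun k hk => Set.indicator_of_notMem
      (fun (h : ∀ i ≤ k, η (i * s) ω ∈ ({o}ᶜ : Set V)) => h j hk hj) _
  rcases le_total K j with h | h
  · exact (gridTime_le s K ω).trans (ENNReal.coe_le_coe.2 (by gcongr))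
  · refine le_trans (le_of_eq ?_) (gridTime_le (η := η) (o := o) s j ω)
    rw [gridTime, gridTime, ← Finset.sum_range_add_sum_Ico _ h]
    rw [Finset.sum_eq_zero (s := Finset.Ico j K) fun k hk => hzero k (Finset.mem_Ico.1 hk).1,
      add_zero]

/-- A grid might miss a short visit to `o`, but by right-continuity all sufficiently fine dyadic
grids see `o` before any given time later than the visit. -/
lemma limsup_gridTime_le {ω : Ω} (hω : ∀ t, ∀ᶠ s in 𝓝[≥] t, η s ω = η t ω) (K : ℕ → ℕ) :
    limsup (fun n => gridTime η o ((2⁻¹ : ℝ≥0) ^ n) (K n) ω) atTop ≤ hittingTime η o ω := by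
  refine le_of_forall_gt fun a ha => ?_
  obtain ⟨t, ht, hta⟩ := hittingTime_lt_iff.1 ha
  obtain ⟨b, htb, hba⟩ := ENNReal.lt_iff_exists_nnreal_btwn.1 hta
  refine lt_of_le_of_lt (limsup_le_of_le (h := ?_)) hba
  filter_upwards [eventually_exists_dyadic_hit hω ht (ENNReal.coe_lt_coe.1 htb)] with n hn
  obtain ⟨j, hj, hjo⟩ := hn
  exact (gridTime_le_of_hit hjo _).trans (ENNReal.coe_le_coe.2 hj.le)

variable [MeasurableSpace Ω] {P : V → Measure Ω}
variable [Fintype V] [DecidableEq V] {G : SimpleGraph V} [DecidableRel G.Adj]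

/-- Optional stopping for the walk observed at times `0, s, …, K s`. -/
lemma IsSimpleRandomWalk.le_sum_killedLaw_add (hη : IsSimpleRandomWalk G P η) {f : V → ℝ}
    (hfo : f o = 0) {s : ℝ≥0} {r : ℝ}
    (hf : ∀ x, x ≠ o → f x - r ≤ ∑ y, transition G s x y * f y) {v : V} (hv : v ≠ o) (K : ℕ) :
    f v ≤ ∑ x, killedLaw P η {o}ᶜ s v K x * f x +
      r * ∑ k ∈ Finset.range K, (P v).real (stays η {o}ᶜ s k) := by
  induction K with
  | zero => simp [hη.killedLaw_zero s (show v ∈ ({o}ᶜ : Set V) from hv)]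
  | succ K ih =>
    have h1 : ∑ y, killedLaw P η {o}ᶜ s v (K + 1) y * f y =
        ∑ x, killedLaw P η {o}ᶜ s v K x * ∑ y, transition G s x y * f y := by
      simp_rw [Finset.mul_sum]
      rw [Finset.sum_comm]
      refine Finset.sum_congr rfl fun y _ => ?_
      by_cases hy : y = o
      · simp [hy, hfo]
      · rw [hη.killedLaw_succ s v K (show y ∈ ({o}ᶜ : Set V) from hy), Finset.sum_mul]
        exact Finset.sum_congr rfl fun x _ => mul_assoc _ _ _
    have h2 : ∑ x, killedLaw P η {o}ᶜ s v K x * f x - r * (P v).real (stays η {o}ᶜ s K) ≤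
        ∑ x, killedLaw P η {o}ᶜ s v K x * ∑ y, transition G s x y * f y := by
      rw [← hη.sum_killedLaw, Finset.mul_sum, ← Finset.sum_sub_distrib]
      refine Finset.sum_le_sum fun x _ => ?_
      by_cases hx : x = o
      · simp [killedLaw_of_notMem s v K (show x ∉ ({o}ᶜ : Set V) by simpa using hx)]
      · calc _ = killedLaw P η {o}ᶜ s v K x * (f x - r) := by ring
          _ ≤ _ := mul_le_mul_of_nonneg_left (hf x hx) (killedLaw_nonneg _ _ _ _ _)
    rw [Finset.sum_range_succ, h1]
    linarith

/-- First-order expansion of the semigroup at `0`; `c` absorbs the `o(s)` error. -/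
lemma eventually_le_sum_transition_mul {f : V → ℝ}
    (hf : ∀ x, x ≠ o → -1 ≤ (generator G).mulVec f x) {c : ℝ} (hc : 0 < c) :
    ∀ᶠ s : ℝ in 𝓝 0, 0 ≤ s → ∀ x, x ≠ o →
      f x - s * (1 + c) ≤ ∑ y, transition G s x y * f y := by
  suffices h : ∀ x, ∀ᶠ s : ℝ in 𝓝 0, 0 ≤ s → x ≠ o →
      f x - s * (1 + c) ≤ ∑ y, transition G s x y * f y by
    filter_upwards [eventually_all.2 h] with s hs h0 x hx using hs x h0 hx
  intro x
  have hd : HasDerivAt (fun s => ∑ y, transition G s x y * f y) ((generator G).mulVec f x) 0 := by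
    simp only [Matrix.mulVec, dotProduct]
    exact HasDerivAt.fun_sum fun y _ => (hasDerivAt_transition_zero G x y).mul_const (f y)
  have ho := (hasDerivAt_iff_isLittleO_nhds_zero.1 hd).def hc
  filter_upwards [ho] with s hs h0 hx
  have h1 : ∑ y, transition G 0 x y * f y = f x := by simp [transition_zero, Matrix.one_apply]
  rw [zero_add, h1, Real.norm_eq_abs, Real.norm_eq_abs, abs_of_nonneg h0, smul_eq_mul] at hs
  have h2 := (abs_le.1 hs).1
  have h3 := mul_le_mul_of_nonneg_left (hf x hx) h0
  linarith

lemma IsSimpleRandomWalk.measurable_gridTime (hη : IsSimpleRandomWalk G P η) (o : V) (s : ℝ≥0)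
    (K : ℕ) : Measurable (gridTime η o s K) :=
  Finset.measurable_sum _ fun k _ =>
    measurable_const.indicator (hη.measurableSet_stays {o}ᶜ s k)

lemma IsSimpleRandomWalk.lintegral_gridTime (hη : IsSimpleRandomWalk G P η) (o : V) (s : ℝ≥0)
    (K : ℕ) (v : V) : ∫⁻ ω, gridTime η o s K ω ∂(P v) =
      ENNReal.ofReal (s * ∑ k ∈ Finset.range K, (P v).real (stays η {o}ᶜ s k)) := by
  have := hη.isProbabilityMeasure v
  simp only [gridTime]
  rw [lintegral_finsetSum _ fun k _ =>
    measurable_const.indicator (hη.measurableSet_stays {o}ᶜ s k), Finset.mul_sum,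
    ENNReal.ofReal_sum_of_nonneg fun k _ => by positivity]
  refine Finset.sum_congr rfl fun k _ => ?_
  rw [lintegral_indicator_const (hη.measurableSet_stays {o}ᶜ s k), ENNReal.ofReal_mul NNReal.zero_le_coe,
    ofReal_measureReal, ENNReal.ofReal_coe_nnreal]

/-- A nonnegative function that vanishes at `o` and has drift at least `-1` elsewhere is a lower
bound for the expected hitting time of `o`. -/
theorem IsSimpleRandomWalk.le_expectedHittingTime (hη : IsSimpleRandomWalk G P η) {f : V → ℝ}
    (hf0 : ∀ x, 0 ≤ f x) (hfo : f o = 0) (hf : ∀ x, x ≠ o → -1 ≤ (generator G).mulVec f x)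
    (v : V) : ENNReal.ofReal (f v) ≤ expectedHittingTime P η v o := by
  rcases eq_or_ne v o with rfl | hv
  · simp [hfo]
  have := hη.isProbabilityMeasure v
  set H : ℝ := ∑ x, f x
  have hH : 0 ≤ H := Finset.sum_nonneg fun x _ => hf0 x
  have hfH : ∀ x, f x ≤ H := fun x =>
    Finset.single_le_sum (fun x _ => hf0 x) (Finset.mem_univ x)
  set d : ℕ → ℝ≥0 := fun n => (2⁻¹ : ℝ≥0) ^ n with hd
  have hd0 : Tendsto (fun n => (d n : ℝ)) atTop (𝓝 0) := by
    simp only [hd, NNReal.coe_pow]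
    exact tendsto_pow_atTop_nhds_zero_of_lt_one (by positivity) (by norm_num)
  -- Here `m` is the time horizon and `1 / m` the slack in the drift. The term left at the horizon
  -- costs a factor `H / m` and the slack `1 / m`, together `(H + 1) / m`.
  have key : ∀ m : ℕ, 1 ≤ m →
      ENNReal.ofReal (f v / (1 + (H + 1) / m)) ≤ expectedHittingTime P η v o := by
    intro m hm
    have hm' : (0 : ℝ) < m := by exact_mod_cast hm
    set K : ℕ → ℕ := fun n => m * 2 ^ n with hK
    have hKd : ∀ n, (K n : ℝ≥0) * d n = m := by
      intro n
      simp only [hK, hd]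
      push_cast
      rw [mul_assoc, ← mul_pow, mul_inv_cancel₀ two_ne_zero, one_pow, mul_one]
    have hev : ∀ᶠ n in atTop, ENNReal.ofReal (f v / (1 + (H + 1) / m)) ≤
        ∫⁻ ω, gridTime η o (d n) (K n) ω ∂(P v) := by
      filter_upwards [hd0.eventually (eventually_le_sum_transition_mul hf
        (c := 1 / m) (by positivity))] with n hn
      rw [hη.lintegral_gridTime]
      refine ENNReal.ofReal_le_ofReal ?_
      rw [div_le_iff₀ (by positivity)]
      set S := ∑ k ∈ Finset.range (K n), (P v).real (stays η {o}ᶜ (d n) k)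
      set u := (P v).real (stays η {o}ᶜ (d n) (K n))
      have h1 := hη.le_sum_killedLaw_add hfo (hn (d n).2) hv (K n)
      have h2 : ∑ x, killedLaw P η {o}ᶜ (d n) v (K n) x * f x ≤ u * H := by
        rw [show u = _ from (hη.sum_killedLaw _ _ _ _).symm, Finset.sum_mul]
        exact Finset.sum_le_sum fun x _ =>
          mul_le_mul_of_nonneg_left (hfH x) (killedLaw_nonneg _ _ _ _ _)
      -- The survival probabilities decrease in `k`, so the last is at most their average (Markov's
      -- inequality for the grid time).
      have h3 : K n * u ≤ S := by
        have : ∑ _k ∈ Finset.range (K n), u ≤ S := by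
          refine Finset.sum_le_sum fun k hk => measureReal_mono fun ω hω j hj => ?_
          exact hω j (hj.trans (Finset.mem_range.1 hk).le)
        simpa using this
      have h4 : u * m ≤ d n * S := by
        have h5 : (K n : ℝ) * d n = m := by exact_mod_cast hKd n
        have := mul_le_mul_of_nonneg_left h3 (d n).2
        calc u * m = d n * (K n * u) := by rw [← h5]; ring
          _ ≤ _ := this
      have h6 : u * H ≤ d n * S * (H / m) := by
        calc u * H = u * m * (H / m) := by field_simp
          _ ≤ _ := mul_le_mul_of_nonneg_right h4 (by positivity)
      calc f v ≤ d n * S * (H / m) + d n * (1 + 1 / m) * S := by linarith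
        _ = d n * S * (1 + (H + 1) / m) := by ring
    calc ENNReal.ofReal (f v / (1 + (H + 1) / m))
        ≤ limsup (fun n => ∫⁻ ω, gridTime η o (d n) (K n) ω ∂(P v)) atTop :=
          le_limsup_of_frequently_le' hev.frequently
      -- Reverse Fatou: every grid time is at most `K n * d n = m`.
      _ ≤ ∫⁻ ω, limsup (fun n => gridTime η o (d n) (K n) ω) atTop ∂(P v) := by
          refine limsup_lintegral_le (fun _ => (m : ℝ≥0∞))
            (fun n => hη.measurable_gridTime o _ _) (fun n => ?_) (by simp)
          refine Eventually.of_forall fun ω => (gridTime_le _ _ _).trans ?_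
          rw [hKd]
          simp
      _ ≤ expectedHittingTime P η v o :=
          lintegral_mono fun ω => limsup_gridTime_le (hη.rightContinuous ω) K
  have hlim : Tendsto (fun m : ℕ => ENNReal.ofReal (f v / (1 + (H + 1) / m))) atTop
      (𝓝 (ENNReal.ofReal (f v))) := by
    refine ENNReal.tendsto_ofReal ?_
    have h1 : Tendsto (fun m : ℕ => (H + 1) / (m : ℝ)) atTop (𝓝 0) :=
      tendsto_const_div_atTop_nhds_zero_nat _
    have h2 := (tendsto_const_nhds (x := f v)).div (h1.const_add 1) (by norm_num)
    rw [add_zero, div_one] at h2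
    exact h2
  exact le_of_tendsto hlim (eventually_atTop.2 ⟨1, key⟩)

end LowerBound

/-! ### Mixing forces the walk across the center of mass -/

section CenterOfMass

variable {V : Type*}

open MeasureTheory

variable [Fintype V] [DecidableEq V] {G : SimpleGraph V} [DecidableRel G.Adj]
  {Ω : Type*} [MeasurableSpace Ω] {P : V → Measure Ω} {η : ℝ≥0 → Ω → V} {o : V}

lemma IsSimpleRandomWalk.expectedHittingTime_self (hη : IsSimpleRandomWalk G P η) (o : V) :
    expectedHittingTime P η o o = 0 := by
  rw [expectedHittingTime, lintegral_eq_zero_iff (hη.measurable_hittingTime o)]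
  have h : ∀ᵐ ω ∂(P o), η 0 ω = o := hη.measure_start_ne o
  filter_upwards [h] with ω hω
  exact le_antisymm (iInf₂_le (0 : ℝ≥0) hω) zero_le

/-- If the walk is mixed up to `ε / 2` at time `t`, then it needs at most `2 t / ε` time units on
average to reach `o` from a side of `o` whose complement has mass at least `ε`. -/
lemma IsSimpleRandomWalk.mul_expectedHittingTime_le (hη : IsSimpleRandomWalk G P η)
    (hG : G.IsTree) {T T' : G.Subgraph} (hT : T.coe.Connected) (hT' : T'.coe.Connected)
    (hi : T.verts ∩ T'.verts = {o}) (hu : T.verts ∪ T'.verts = Set.univ) {ε : ℝ} (hε : 0 < ε)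
    (hm : ε * (Fintype.card V : ℝ) ≤ (T'.verts.ncard : ℝ)) {t : ℝ≥0}
    (ht : ∀ x, tvDist (law P η x t) (uniform V) ≤ ε / 2) {v : V} (hv : v ∈ T.verts)
    (hvo : v ≠ o) :
    ENNReal.ofReal (ε / 2) * expectedHittingTime P η v o ≤ t := by
  classical
  have hmass : ∀ x, ∑ y with y ∈ T.verts \ {o}, transition G t x y ≤ 1 - ε / 2 := by
    intro x
    have hcard : (0 : ℝ) < Fintype.card V := by
      have : Nonempty V := ⟨v⟩
      exact_mod_cast Fintype.card_pos
    set A : Finset V := {y | y ∈ T'.verts} with hA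
    have hAc : ((Finset.univ.filter fun y => y ∈ T.verts \ {o}) : Finset V) ⊆ Aᶜ := by
      intro y hy
      simp only [Finset.mem_filter, Finset.mem_univ, true_and, Finset.mem_compl, hA] at hy ⊢
      exact fun hy' => hy.2 (hi.subset ⟨hy.1, hy'⟩)
    have h1 : ε ≤ ∑ a ∈ A, uniform V a := by
      have : T'.verts.ncard = A.card := by
        rw [← Set.ncard_coe_finset]; simp [hA]
      simp only [uniform, Finset.sum_const, nsmul_eq_mul, mul_one_div]
      rw [le_div_iff₀ hcard, ← this]
      exact hm
    have h2 : |∑ a ∈ A, law P η x t a - ∑ a ∈ A, uniform V a| ≤ ε / 2 :=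
      (Finset.le_sup' (fun A : Finset V => |∑ a ∈ A, law P η x t a - ∑ a ∈ A, uniform V a|)
        (Finset.mem_univ A)).trans (ht x)
    have h3 := (abs_le.1 h2).1
    have h4 : ∑ y with y ∈ T.verts \ {o}, transition G t x y ≤ ∑ y ∈ Aᶜ, transition G t x y :=
      Finset.sum_le_sum_of_subset_of_nonneg hAc fun y _ _ => hη.transition_nonneg x t y
    have h5 := Finset.sum_add_sum_compl A fun y => transition G t x y
    rw [sum_transition] at h5
    simp_rw [hη.law_eq] at h3
    linarith
  -- At time `0` the walk from `v` is in `T \ {o}` with probability `1 > 1 - ε / 2`.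
  have ht0 : 0 < t := by
    refine pos_iff_ne_zero.2 fun h0 => ?_
    have h1 := hmass v
    rw [h0, NNReal.coe_zero, transition_zero, Finset.sum_filter,
      Finset.sum_eq_single v (fun y _ hy => by simp [hy.symm]) (by simp)] at h1
    simp only [Set.mem_sdiff, hv, Set.mem_singleton_iff, hvo, not_false_eq_true, and_self,
      if_true, Matrix.one_apply_eq] at h1
    linarith
  have h := hη.expectedHittingTime_le (o := o) (U := T.verts \ {o}) (W := T'.verts \ {o})
    (Set.disjoint_left.2 fun x hx hx' => hx.2 (hi.subset ⟨hx.1, hx'.1⟩))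
    (fun x hx y hy => not_adj_of_inter_eq_singleton hG hT hT' hi hx.1 hy.1 hx.2 hy.2)
    (fun x hx => (hu.symm.subset (Set.mem_univ x)).imp (fun h => ⟨h, hx⟩) fun h => ⟨h, hx⟩)
    ⟨hv, hvo⟩ ht0 (fun x _ => hmass x)
  rw [sub_sub_cancel] at h
  calc ENNReal.ofReal (ε / 2) * expectedHittingTime P η v o
      ≤ ENNReal.ofReal (ε / 2) * (t * (ENNReal.ofReal (ε / 2))⁻¹) := mul_le_mul_right h _
    _ = t := by
      rw [mul_left_comm, ENNReal.mul_inv_cancel (by simpa using hε) ENNReal.ofReal_ne_top, mul_one]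

end CenterOfMass

end TreeWalk

end

theorem proposition3p2 {V : Type*} [Fintype V] [DecidableEq V]
    (G : SimpleGraph V) [DecidableRel G.Adj] (hG : G.IsTree) (o : V)
    {Ω : Type*} [MeasurableSpace Ω] (P : V → MeasureTheory.Measure Ω) (η : ℝ≥0 → Ω → V)
    (hη : TreeWalk.IsSimpleRandomWalk G P η)
    (δ : ℝ) (hδ : 0 < δ) (ho : TreeWalk.IsCenterOfMass G δ o)
    (ε : ℝ) (hε : 0 < ε) (hεδ : ε ≤ δ) :
    ENNReal.ofReal (ε / 2) * (⨆ v : V, TreeWalk.expectedHittingTime P η v o)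
        ≤ (TreeWalk.mixingTime P η (ε / 2) : ℝ≥0∞) ∧
    ENNReal.ofReal (ε / (2 * (G.maxDegree : ℝ)) *
        ((Finset.univ.sup fun v : V =>
          ∑ e ∈ TreeWalk.pathEdges G o v, (TreeWalk.edgeSubtreeVerts G o e).card : ℕ) : ℝ))
      ≤ ENNReal.ofReal (ε / 2) * (⨆ v : V, TreeWalk.expectedHittingTime P η v o) := by
  constructor
  · obtain ⟨T, T', hT, hT', hi, hu, hm, hm'⟩ := ho
    -- Nonemptiness is essential: the infimum of the empty set would be `0`, so convergence to
    -- equilibrium is used here.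
    have hne : {t : ℝ≥0 | ∀ x, TreeWalk.tvDist (TreeWalk.law P η x t) (TreeWalk.uniform V) ≤
        ε / 2}.Nonempty := hη.exists_tvDist_le hG.connected (half_pos hε)
    rw [TreeWalk.mixingTime, ENNReal.coe_sInf hne, ENNReal.mul_iSup]
    refine iSup_le fun v => le_iInf₂ fun t ht => ?_
    have hmono : ε * (Fintype.card V : ℝ) ≤ δ * (Fintype.card V : ℝ) := by gcongr
    rcases eq_or_ne v o with rfl | hvo
    · simp [hη.expectedHittingTime_self]
    rcases hu.symm.subset (Set.mem_univ v) with hv | hv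
    · exact hη.mul_expectedHittingTime_le hG hT.connected hT'.connected hi hu hε
        (hmono.trans hm') ht hv hvo
    · exact hη.mul_expectedHittingTime_le hG hT'.connected hT.connected
        (by rw [Set.inter_comm, hi]) (by rw [Set.union_comm, hu]) hε (hmono.trans hm) ht hv hvo
  · have : Nonempty V := ⟨o⟩
    obtain ⟨v, -, hv⟩ := Finset.exists_mem_eq_sup (Finset.univ : Finset V) Finset.univ_nonempty
      (TreeWalk.pathWeight G o)
    have hw : (Finset.univ.sup fun v : V => ∑ e ∈ TreeWalk.pathEdges G o v,
        (TreeWalk.edgeSubtreeVerts G o e).card) = TreeWalk.pathWeight G o v := hv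
    rw [hw]
    -- When the maximum degree is `0`, division by zero makes the left side `0`.
    have hle : ε / (2 * (G.maxDegree : ℝ)) ≤ ε / 2 := by
      rcases Nat.eq_zero_or_pos G.maxDegree with h0 | h0
      · simp only [h0, Nat.cast_zero, mul_zero, div_zero]; positivity
      · have : (1 : ℝ) ≤ G.maxDegree := by exact_mod_cast h0
        exact div_le_div_of_nonneg_left hε.le two_pos (by linarith)
    have hlow := hη.le_expectedHittingTime (o := o)
      (f := fun v => (TreeWalk.pathWeight G o v : ℝ)) (fun x => Nat.cast_nonneg _)
      (by simp [TreeWalk.pathWeight_self])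
      (fun x hx => TreeWalk.neg_one_le_generator_mulVec_pathWeight hG hx) v
    calc _ ≤ ENNReal.ofReal (ε / 2 * (TreeWalk.pathWeight G o v : ℝ)) := by gcongr
      _ = ENNReal.ofReal (ε / 2) * ENNReal.ofReal (TreeWalk.pathWeight G o v : ℝ) :=
        ENNReal.ofReal_mul (by positivity)
      _ ≤ _ := by
        gcongr
        exact hlow.trans (le_iSup (fun v => TreeWalk.expectedHittingTime P η v o) v)
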